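/- Let $n\ge 1$, let $X=\{x\in\mathbb{R}^n : \ell_i\le x_i\le u_i \text{ for all } i\}$ with $\ell_i<u_i$ for all $i$, and let $g:\mathbb{R}^n\to\mathbb{R}$ be a convex function (being real-valued, it is automatically closed and proper). For $x^*\in\mathbb{R}^n$ and a subgradient $c\in\partial g(x^*)$ put $s_{x^*,c}(x)=g(x^*)+c^{\mathsf T}(x-x^*)$ and $H(x^*,c)=\{(x,t)\in\mathbb{R}^n\times\mathbb{R} : t\ge s_{x^*,c}(x)\}$. Consider the following cutting-plane algorithm with tolerance $\epsilon=0$. Choose $x^0\in\operatorname{int}X$ (for instance $x^0=\frac{\ell+u}{2}$) and $c^0\in\partial g(x^0)$, and set $C^0=H(x^0,c^0)\cap(X\times\mathbb{R})$, $g^0=s_{x^0,c^0}$. At iteration $k\ge 0$ choose a vertex $(\bar x,\bar y)$ of $C^k$ that maximizes $g(x)-y$ over all vertices $(x,y)$ of $C^k$. If $g(\bar x)-\bar y>0$, choose $\bar c\in\partial g(\bar x)$ and set $C^{k+1}=C^k\cap H(\bar x,\bar c)$, $g^{k+1}=\max\{g^k,s_{\bar x,\bar c}\}$. Otherwise stop;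 in this case put $C^{j}=C^k$ and $g^{j}=g^k$ for all $j>k$. Let $b=\sup_{x\in X}g(x)$ and $$A=\{(x,t)\in X\times\mathbb{R} : g(x)\le t\le b\},\qquad A^k=\{(x,t)\in X\times\mathbb{R} : g^k(x)\le t\le b\}=\{(x,t)\in C^k : t\le b\}.$$ Fix an arbitrary norm on $\mathbb{R}^n\times\mathbb{R}$ and let $\delta^H(B,D)=\max\{\sup_{x\in B}\inf_{y\in D}\|x-y\|,\ \sup_{y\in D}\inf_{x\in B}\|x-y\|\}$ be the Hausdorff distance. Then there is a constant $M>0$, depending only on $n$, $g$, $X$ and the norm, such that for every sequence $(A^k)_{k\ge0}$ produced by the algorithm: (a) $\delta^H(A^k,A)\le M\,k^{-1/n}$ for all sufficiently large $k$, that is, the approximation error is of order $\mathcal{O}(k^{-1/n})$; (b) $\lim_{k\to\infty}\delta^H(A^k,A)=0$. -/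

import Mathlib

open Set Filter Topology
open scoped ENNReal

namespace CuttingPlane

/-- The space `ℝⁿ`, without a preferred norm. -/
abbrev Vec (n : ℕ) : Type := Fin n → ℝ

/-- The space `ℝⁿ × ℝ = ℝⁿ⁺¹`, in which epigraphs live. -/
abbrev Pt (n : ℕ) : Type := Vec n × ℝ

/-- The epigraph of a real-valued function on `ℝⁿ`. -/
def epi {n : ℕ} (f : Vec n → ℝ) : Set (Pt n) := {z | f z.1 ≤ z.2}

/-- The subdifferential of `g` at `x₀`. -/
def subdiff {n : ℕ} (g : Vec n → ℝ) (x₀ : Vec n) : Set (Vec n) :=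
  {c | ∀ x, g x₀ + c ⬝ᵥ (x - x₀) ≤ g x}

/-- The affine function `s(x) = g(x₀) + cᵀ (x - x₀)`. -/
def affineAt {n : ℕ} (g : Vec n → ℝ) (x₀ c : Vec n) : Vec n → ℝ :=
  fun x => g x₀ + c ⬝ᵥ (x - x₀)

/-- The halfspace `{(x, t) | t - cᵀ x ≥ g(x₀) - cᵀ x₀}`; it supports `epi g` at `(x₀, g(x₀))`
when `c` is a subgradient of `g` at `x₀`. -/
def halfspaceAt {n : ℕ} (g : Vec n → ℝ) (x₀ c : Vec n) : Set (Pt n) :=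
  {z | g x₀ - c ⬝ᵥ x₀ ≤ z.2 - c ⬝ᵥ z.1}

/-- The cylinder `X × ℝ` over the box `X = [l, u]`. -/
def boxCyl {n : ℕ} (l u : Vec n) : Set (Pt n) := Icc l u ×ˢ univ

/-- The vertices of a polyhedral convex set are its extreme points. -/
def ver {n : ℕ} (C : Set (Pt n)) : Set (Pt n) := C.extremePoints ℝ

/-- A run of the cutting-plane algorithm for `g` on the box `[l, u]` with tolerance `ε`.
All choices which the algorithm leaves open (the starting point in the interior of the box, the
maximising vertex, the subgradients) are part of the data. If the algorithm stops at iteration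
`K`, the sets and functions of the run are kept constant from `K` on. -/
structure Run {n : ℕ} (g : Vec n → ℝ) (l u : Vec n) (ε : ℝ) where
  /-- the starting point -/
  x0 : Vec n
  /-- the subgradient used at the starting point -/
  c0 : Vec n
  /-- the outer approximations of `epi g ∩ (X × ℝ)` -/
  C : ℕ → Set (Pt n)
  /-- the polyhedral underestimators of `g` -/
  G : ℕ → Vec n → ℝ
  /-- the vertex of `C k` selected at iteration `k` -/
  v : ℕ → Pt n
  /-- the subgradient used at iteration `k` -/
  c : ℕ → Vec n
  x0_mem : x0 ∈ interior (Icc l u)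
  c0_mem : c0 ∈ subdiff g x0
  C_zero : C 0 = halfspaceAt g x0 c0 ∩ boxCyl l u
  G_zero : G 0 = affineAt g x0 c0
  v_mem : ∀ k, v k ∈ ver (C k)
  v_max : ∀ k, ∀ z ∈ ver (C k), g z.1 - z.2 ≤ g (v k).1 - (v k).2
  c_mem : ∀ k, c k ∈ subdiff g (v k).1
  C_cut : ∀ k, ε < g (v k).1 - (v k).2 → C (k + 1) = C k ∩ halfspaceAt g (v k).1 (c k)
  G_cut : ∀ k, ε < g (v k).1 - (v k).2 →
    G (k + 1) = fun x => max (G k x) (affineAt g (v k).1 (c k) x)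
  C_halt : ∀ k, g (v k).1 - (v k).2 ≤ ε → C (k + 1) = C k
  G_halt : ∀ k, g (v k).1 - (v k).2 ≤ ε → G (k + 1) = G k

/-- The set `epi f ∩ (X × ℝ) ∩ {(x, t) | t ≤ b}` with `X = [l, u]`, `b = sup_X g`. -/
def truncEpi {n : ℕ} (g : Vec n → ℝ) (l u : Vec n) (f : Vec n → ℝ) : Set (Pt n) :=
  epi f ∩ boxCyl l u ∩ {z | z.2 ≤ sSup (g '' Icc l u)}

/-- The distance from the point `y` to the set `A`, with respect to the (semi)norm `p`;
it is `∞` when `A` is empty. -/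
noncomputable def distTo {n : ℕ} (p : Seminorm ℝ (Pt n)) (y : Pt n) (A : Set (Pt n)) : ℝ≥0∞ :=
  ⨅ x ∈ A, ENNReal.ofReal (p (y - x))

/-- The Hausdorff distance with respect to the (semi)norm `p`, as an extended real number. -/
noncomputable def hausdorff {n : ℕ} (p : Seminorm ℝ (Pt n)) (A B : Set (Pt n)) : ℝ≥0∞ :=
  max (⨆ x ∈ A, distTo p x B) (⨆ y ∈ B, distTo p y A)

/-- In every run the outer approximations are `C k = epi (G k) ∩ (X × ℝ)`, so that
`truncEpi g l u (G k)` is also `C k ∩ {(x, t) | t ≤ b}`. -/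
theorem Run.C_eq {n : ℕ} {g : Vec n → ℝ} {l u : Vec n} {ε : ℝ} (R : Run g l u ε) (k : ℕ) :
    R.C k = epi (R.G k) ∩ boxCyl l u := by
  have key : ∀ x c : Vec n, halfspaceAt g x c = epi (affineAt g x c) := by
    intro x c
    ext z
    simp only [halfspaceAt, epi, affineAt, mem_ofPred_eq, dotProduct_sub]
    constructor <;> intro h <;> linarith
  induction k with
  | zero => rw [R.C_zero, R.G_zero, key]
  | succ k ih =>
    by_cases h : ε < g (R.v k).1 - (R.v k).2
    · rw [R.C_cut k h, R.G_cut k h, ih, key]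
      ext z
      simp only [epi, mem_inter_iff, mem_ofPred_eq, max_le_iff]
      tauto
    · rw [R.C_halt k (not_lt.mp h), R.G_halt k (not_lt.mp h), ih]

end CuttingPlane

namespace CuttingPlane

/-! Let `gap k` be the violation `g x - y` at the vertex chosen in iteration `k`. A convex function
on `C k` is controlled by the vertices, so `gap k` bounds the violation on all of `C k`
(`Run.sub_le_gap`). Lifting points vertically then bounds the Hausdorff distance by `gap k * p (0,
1)`, and nestedness of the `C k` makes `gap` antitone. A vertex chosen after the cut at `v j` lies
above that cut. As subgradients over the box are bounded by some `L`, this gives `gap k ≤ 2 * L * ‖x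
k - x j‖` for `j < k`, where `x i` is the base point of `v i`. By pigeonhole on a grid of `N ^ n`
cells, two of the first `N ^ n + 1` base points are within `O(1 / N)`. Taking `N = ⌊k ^ (1 / n)⌋`
yields the rate. -/

theorem continuous_of_convexOn_univ {n : ℕ} {g : Vec n → ℝ} (hg : ConvexOn ℝ univ g) :
    Continuous g :=
  continuousOn_univ.mp (hg.continuousOn isOpen_univ)

/-- An extreme point of a truncated convex set that lies strictly below the truncation level is
an extreme point of the whole set. -/
theorem mem_ver_of_mem_ver_inter {n : ℕ} {C : Set (Pt n)} (hC : Convex ℝ C) {T : ℝ} {e : Pt n}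
    (he : e ∈ ver (C ∩ {z | z.2 ≤ T})) (heT : e.2 < T) : e ∈ ver C := by
  refine ⟨he.1.1, fun a ha b hb hab => ?_⟩
  obtain ⟨α, β, hα, hβ, hαβ, hcomb⟩ := hab
  set δ := T - e.2 with hδ
  have hδ0 : 0 < δ := sub_pos.mpr heT
  have hA := abs_nonneg (a.2 - e.2)
  have hB := abs_nonneg (b.2 - e.2)
  -- Shrinking the segment towards `e` by the factor `s` raises heights by at most `δ`, so both new
  -- endpoints stay below level `T`.
  set s := δ / (|a.2 - e.2| + |b.2 - e.2| + δ) with hs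
  have hden : 0 < |a.2 - e.2| + |b.2 - e.2| + δ := by positivity
  have hs0 : 0 < s := by positivity
  have hs1 : s ≤ 1 := (div_le_one hden).2 (by linarith)
  have hsδ : s * (|a.2 - e.2| + |b.2 - e.2| + δ) = δ := div_mul_cancel₀ _ hden.ne'
  have hmem : ∀ c ∈ C, |c.2 - e.2| ≤ |a.2 - e.2| + |b.2 - e.2| →
      e + s • (c - e) ∈ C ∩ {z | z.2 ≤ T} := by
    intro c hc hle
    refine ⟨?_, ?_⟩
    · have := hC he.1.1 hc (sub_nonneg.2 hs1) hs0.le (by ring)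
      convert this using 1
      module
    · have h1 : s * (c.2 - e.2) ≤ s * (|a.2 - e.2| + |b.2 - e.2| + δ) :=
        mul_le_mul_of_nonneg_left (by linarith [le_abs_self (c.2 - e.2)]) hs0.le
      simp only [mem_ofPred_eq, Prod.snd_add, Prod.smul_snd, Prod.snd_sub, smul_eq_mul]
      linarith
  have hseg : e ∈ openSegment ℝ (e + s • (a - e)) (e + s • (b - e)) := by
    refine ⟨α, β, hα, hβ, hαβ, ?_⟩
    have : α • (e + s • (a - e)) + β • (e + s • (b - e))
        = (α + β) • e + s • ((α • a + β • b) - (α + β) • e) := by module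
    rw [this, hαβ, hcomb]
    module
  have h := he.2 (hmem a ha (by linarith)) (hmem b hb (by linarith)) hseg
  have h0 : s • (a - e) = 0 := by simpa using h
  exact sub_eq_zero.1 ((smul_eq_zero.1 h0).resolve_left hs0.ne')

theorem isClosed_halfspaceAt {n : ℕ} (g : Vec n → ℝ) (x c : Vec n) :
    IsClosed (halfspaceAt g x c) := by
  unfold halfspaceAt dotProduct
  exact isClosed_le (by fun_prop) (by fun_prop)

theorem convex_halfspaceAt {n : ℕ} (g : Vec n → ℝ) (x c : Vec n) :
    Convex ℝ (halfspaceAt g x c) := by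
  intro a ha b hb α β hα hβ hαβ
  simp only [halfspaceAt, mem_ofPred_eq, Prod.fst_add, Prod.snd_add, Prod.smul_fst, Prod.smul_snd,
    dotProduct_add, dotProduct_smul, smul_eq_mul] at *
  have hβ' : β = 1 - α := by linarith
  subst hβ'
  nlinarith [mul_le_mul_of_nonneg_left ha hα, mul_le_mul_of_nonneg_left hb hβ]

theorem mem_halfspaceAt_of_mem_subdiff {n : ℕ} {g : Vec n → ℝ} {x c : Vec n}
    (hc : c ∈ subdiff g x) {z : Pt n} (hz : g z.1 ≤ z.2) : z ∈ halfspaceAt g x c := by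
  have := hc z.1
  simp only [dotProduct_sub] at this
  simp only [halfspaceAt, mem_ofPred_eq]
  linarith

/-- Subgradients over a bounded set are uniformly bounded. -/
theorem exists_subdiff_bound {n : ℕ} {g : Vec n → ℝ} (hg : Continuous g) (l u : Vec n) :
    ∃ L : ℝ, 0 < L ∧ ∀ x ∈ Icc l u, ∀ c ∈ subdiff g x, ∀ w, c ⬝ᵥ w ≤ L * ‖w‖ := by
  -- The box is enlarged by 1 so that a unit step from any of its points remains where `g` is
  -- bounded.
  obtain ⟨B, hB⟩ := ((isCompact_Icc (a := l - 1) (b := u + 1)).image hg).isBounded.exists_norm_le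
  have hB' : ∀ x ∈ Icc (l - 1) (u + 1), |g x| ≤ B := fun x hx => hB _ (mem_image_of_mem g hx)
  refine ⟨2 * |B| + 1, by positivity, fun x hx c hc w => ?_⟩
  rcases eq_or_ne w 0 with rfl | hw
  · simp
  have hw0 : 0 < ‖w‖ := norm_pos_iff.2 hw
  have hd : ‖‖w‖⁻¹ • w‖ = 1 := by rw [norm_smul, norm_inv, norm_norm, inv_mul_cancel₀ hw0.ne']
  have hdi : ∀ i, |(‖w‖⁻¹ • w) i| ≤ 1 := fun i => hd ▸ norm_le_pi_norm (‖w‖⁻¹ • w) i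
  have h1 := hB' x ⟨fun i => by simpa using (hx.1 i).trans (by linarith),
    fun i => (hx.2 i).trans (by simp)⟩
  have h2 := hB' (x + ‖w‖⁻¹ • w)
    ⟨fun i => by
      have := (abs_le.1 (hdi i)).1
      have := hx.1 i
      simp only [Pi.sub_apply, Pi.add_apply, Pi.one_apply] at *
      linarith,
     fun i => by
      have := (abs_le.1 (hdi i)).2
      have := hx.2 i
      simp only [Pi.add_apply, Pi.one_apply] at *
      linarith⟩
  have h3 := hc (x + ‖w‖⁻¹ • w)
  rw [add_sub_cancel_left, dotProduct_smul, smul_eq_mul] at h3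
  have h4 : ‖w‖⁻¹ * (c ⬝ᵥ w) ≤ 2 * |B| + 1 := by
    linarith [(abs_le.1 h1).1, (abs_le.1 h2).2, le_abs_self B]
  rw [inv_mul_le_iff₀ hw0] at h4
  linarith

/-- Among more than `N ^ n` points of a box, two are at distance less than `D / N`. -/
theorem exists_lt_norm_sub_le {n : ℕ} (l u : Vec n) {N K : ℕ} (hN : 0 < N) (hK : N ^ n ≤ K)
    (x : ℕ → Vec n) (hx : ∀ k, x k ∈ Icc l u) :
    ∃ j k, j < k ∧ k ≤ K ∧ ‖x k - x j‖ ≤ (‖u - l‖ + 1) / N := by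
  -- The `+ 1` makes `D` exceed every side length, so the cell index stays below `N` even on the
  -- upper faces.
  set D := ‖u - l‖ + 1 with hD
  have hD0 : 0 < D := by positivity
  have hN0 : (0 : ℝ) < N := Nat.cast_pos.2 hN
  have h0 : ∀ k i, 0 ≤ N * (x k i - l i) / D := fun k i => by
    have := sub_nonneg.2 ((hx k).1 i)
    positivity
  have hlt : ∀ k i, N * (x k i - l i) / D < N := fun k i => by
    rw [div_lt_iff₀ hD0]
    refine mul_lt_mul_of_pos_left ?_ hN0
    have h1 := (hx k).2 i
    have h2 := (le_abs_self _).trans (norm_le_pi_norm (u - l) i)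
    simp only [Pi.sub_apply] at h2
    linarith
  let cell : Fin (K + 1) → (Fin n → Fin N) := fun k i =>
    ⟨⌊N * (x k i - l i) / D⌋₊, (Nat.floor_lt (h0 k i)).2 (hlt k i)⟩
  obtain ⟨a, b, hab, hcell⟩ := Fintype.exists_ne_map_eq_of_card_lt cell (by simp; omega)
  have key : ∀ a b : Fin (K + 1), cell a = cell b → ‖x b - x a‖ ≤ D / N := by
    intro a b hab
    refine (pi_norm_le_iff_of_nonneg (by positivity)).2 fun i => ?_
    have hi : ⌊N * (x a i - l i) / D⌋₊ = ⌊N * (x b i - l i) / D⌋₊ :=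
      congrArg Fin.val (congrFun hab i)
    have ha1 := Nat.floor_le (h0 a i)
    have ha2 := Nat.lt_floor_add_one (N * (x a i - l i) / D)
    have hb1 := Nat.floor_le (h0 b i)
    have hb2 := Nat.lt_floor_add_one (N * (x b i - l i) / D)
    rw [hi] at ha1 ha2
    have hdiff : N * (x b i - l i) / D - N * (x a i - l i) / D = (x b i - x a i) * (N / D) := by
      field_simp
      ring
    have habs : |(x b i - x a i) * (N / D)| ≤ 1 := by
      rw [← hdiff, abs_le]
      constructor <;> linarith
    rw [abs_mul, abs_of_pos (by positivity : (0 : ℝ) < N / D)] at habs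
    rw [Pi.sub_apply, Real.norm_eq_abs]
    rw [← le_div_iff₀ (by positivity), one_div_div] at habs
    exact habs
  rcases lt_or_gt_of_ne hab with h | h
  · exact ⟨a, b, h, Nat.lt_succ_iff.1 b.2, key a b hcell⟩
  · exact ⟨b, a, h, Nat.lt_succ_iff.1 a.2, key b a hcell.symm⟩

namespace Run

variable {n : ℕ} {g : Vec n → ℝ} {l u : Vec n} {ε : ℝ} (R : Run g l u ε)

/-- The largest violation found at iteration `k`. -/
def gap (k : ℕ) : ℝ := g (R.v k).1 - (R.v k).2

theorem C_succ_subset (k : ℕ) : R.C (k + 1) ⊆ R.C k := by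
  by_cases h : ε < g (R.v k).1 - (R.v k).2
  · rw [R.C_cut k h]
    exact inter_subset_left
  · rw [R.C_halt k (not_lt.1 h)]

theorem C_antitone : Antitone R.C := antitone_nat_of_succ_le R.C_succ_subset

theorem v_mem_C (k : ℕ) : R.v k ∈ R.C k := (R.v_mem k).1

theorem v_mem_Icc (k : ℕ) : (R.v k).1 ∈ Icc l u := by
  have h := R.v_mem_C k
  rw [R.C_eq] at h
  exact h.2.1

theorem isClosed_C (k : ℕ) : IsClosed (R.C k) := by
  induction k with
  | zero =>
    rw [R.C_zero]
    exact (isClosed_halfspaceAt _ _ _).inter (isClosed_Icc.prod isClosed_univ)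
  | succ k ih =>
    by_cases h : ε < g (R.v k).1 - (R.v k).2
    · rw [R.C_cut k h]
      exact ih.inter (isClosed_halfspaceAt _ _ _)
    · rwa [R.C_halt k (not_lt.1 h)]

theorem convex_C (k : ℕ) : Convex ℝ (R.C k) := by
  induction k with
  | zero =>
    rw [R.C_zero]
    exact (convex_halfspaceAt _ _ _).inter ((convex_Icc l u).prod convex_univ)
  | succ k ih =>
    by_cases h : ε < g (R.v k).1 - (R.v k).2
    · rw [R.C_cut k h]
      exact ih.inter (convex_halfspaceAt _ _ _)
    · rwa [R.C_halt k (not_lt.1 h)]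

theorem mem_C_of_le (k : ℕ) {z : Pt n} (hz : z.1 ∈ Icc l u) (hgz : g z.1 ≤ z.2) :
    z ∈ R.C k := by
  induction k with
  | zero =>
    rw [R.C_zero]
    exact ⟨mem_halfspaceAt_of_mem_subdiff R.c0_mem hgz, hz, mem_univ _⟩
  | succ k ih =>
    by_cases h : ε < g (R.v k).1 - (R.v k).2
    · rw [R.C_cut k h]
      exact ⟨ih, mem_halfspaceAt_of_mem_subdiff (R.c_mem k) hgz⟩
    · rwa [R.C_halt k (not_lt.1 h)]

/-- The initial cut bounds the height from below over the box; compactness is what Krein–Milman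
needs. -/
theorem isCompact_C_inter (k : ℕ) (T : ℝ) : IsCompact (R.C k ∩ {z | z.2 ≤ T}) := by
  have hcont : Continuous fun x : Vec n => R.c0 ⬝ᵥ x := by
    unfold dotProduct
    fun_prop
  obtain ⟨m, hm⟩ := ((isCompact_Icc (a := l) (b := u)).image hcont).bddBelow
  refine IsCompact.of_isClosed_subset
    ((isCompact_Icc (a := l) (b := u)).prod
      (isCompact_Icc (a := g R.x0 - R.c0 ⬝ᵥ R.x0 + m) (b := T)))
    ((R.isClosed_C k).inter (isClosed_le continuous_snd continuous_const)) ?_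
  rintro z ⟨hz, hzT⟩
  have h0 := R.C_antitone (Nat.zero_le k) hz
  rw [R.C_zero] at h0
  have h1 : g R.x0 - R.c0 ⬝ᵥ R.x0 ≤ z.2 - R.c0 ⬝ᵥ z.1 := h0.1
  have h2 : m ≤ R.c0 ⬝ᵥ z.1 := hm (mem_image_of_mem _ h0.2.1)
  exact ⟨h0.2.1, by linarith, hzT⟩

/-- The selected vertex maximises the violation over the whole outer approximation. -/
theorem sub_le_gap (hg : ConvexOn ℝ univ g) (k : ℕ) {z : Pt n} (hz : z ∈ R.C k) :
    g z.1 - z.2 ≤ R.gap k := by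
  have hgc := continuous_of_convexOn_univ hg
  obtain ⟨B, hB⟩ := ((isCompact_Icc (a := l) (b := u)).image hgc).bddAbove
  -- The level keeps `z` and is so high that extreme points created by the truncation, at height
  -- `T`, satisfy the bound because `g ≤ B`.
  set T := max z.2 (B - R.gap k)
  have hK := closure_convexHull_extremePoints (R.isCompact_C_inter k T)
    ((R.convex_C k).inter (convex_halfSpace_le (LinearMap.snd ℝ (Vec n) ℝ).isLinear T))
  have hφ : ConvexOn ℝ univ fun z : Pt n => g z.1 - z.2 :=
    (hg.comp_linearMap (LinearMap.fst ℝ (Vec n) ℝ)).sub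
      ((LinearMap.snd ℝ (Vec n) ℝ).concaveOn convex_univ)
  have hconv : Convex ℝ {z : Pt n | g z.1 - z.2 ≤ R.gap k} := by
    simpa using hφ.convex_le (R.gap k)
  have hclosed : IsClosed {z : Pt n | g z.1 - z.2 ≤ R.gap k} :=
    isClosed_le (by fun_prop) continuous_const
  have hext : (R.C k ∩ {z | z.2 ≤ T}).extremePoints ℝ ⊆ {z : Pt n | g z.1 - z.2 ≤ R.gap k} := by
    intro e he
    rcases lt_or_ge e.2 T with h | h
    · exact R.v_max k e (mem_ver_of_mem_ver_inter (R.convex_C k) he h)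
    · have h1 : e ∈ R.C k := he.1.1
      rw [R.C_eq] at h1
      have h2 : g e.1 ≤ B := hB (mem_image_of_mem g h1.2.1)
      have h3 : B - R.gap k ≤ T := le_max_right _ _
      simp only [mem_ofPred_eq]
      linarith
  have hzK : z ∈ R.C k ∩ {z | z.2 ≤ T} := ⟨hz, le_max_left z.2 (B - R.gap k)⟩
  rw [← hK] at hzK
  exact closure_minimal (convexHull_min hext hconv) hclosed hzK

theorem gap_antitone (hg : ConvexOn ℝ univ g) : Antitone R.gap :=
  fun _ k hjk => R.sub_le_gap hg _ (R.C_antitone hjk (R.v_mem_C k))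

/-- The cut at `v j` bounds the height of `v k` from below, and the subgradient inequality of `c k`
at the base point of `v j` bounds `g` at that of `v k` from above. -/
theorem gap_le_dotProduct {j k : ℕ} (hjk : j < k) (hj : ε < R.gap j) :
    R.gap k ≤ R.c k ⬝ᵥ ((R.v k).1 - (R.v j).1) + R.c j ⬝ᵥ ((R.v j).1 - (R.v k).1) := by
  have h := R.C_antitone hjk (R.v_mem_C k)
  rw [Nat.succ_eq_add_one, R.C_cut j hj] at h
  have h1 : g (R.v j).1 - R.c j ⬝ᵥ (R.v j).1 ≤ (R.v k).2 - R.c j ⬝ᵥ (R.v k).1 := h.2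
  have h2 := R.c_mem k (R.v j).1
  simp only [gap, dotProduct_sub] at *
  linarith

/-- The violation decreases at least as fast as the mesh of a grid with `K` cells. -/
theorem gap_le (R : Run g l u 0) (hg : ConvexOn ℝ univ g) {L : ℝ} (hL : 0 < L)
    (hLc : ∀ x ∈ Icc l u, ∀ c ∈ subdiff g x, ∀ w, c ⬝ᵥ w ≤ L * ‖w‖) {N K : ℕ} (hN : 0 < N)
    (hK : N ^ n ≤ K) : R.gap K ≤ 2 * L * ((‖u - l‖ + 1) / N) := by
  rcases le_or_gt (R.gap K) 0 with h | h
  -- If the gap at `K` is positive, so are all earlier gaps, hence the cut at `j` was really made.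
  · exact h.trans (by positivity)
  obtain ⟨j, k, hjk, hkK, hd⟩ := exists_lt_norm_sub_le l u hN hK (fun k => (R.v k).1) R.v_mem_Icc
  have h1 := R.gap_le_dotProduct hjk (h.trans_le (R.gap_antitone hg (hjk.le.trans hkK)))
  have h2 := hLc _ (R.v_mem_Icc k) _ (R.c_mem k) ((R.v k).1 - (R.v j).1)
  have h3 := hLc _ (R.v_mem_Icc j) _ (R.c_mem j) ((R.v j).1 - (R.v k).1)
  rw [norm_sub_rev] at h3
  have h4 := R.gap_antitone hg hkK
  have h5 := mul_le_mul_of_nonneg_left hd hL.le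
  linarith

theorem hausdorff_le (hg : ConvexOn ℝ univ g) (p : Seminorm ℝ (Pt n)) (k : ℕ) :
    hausdorff p (truncEpi g l u (R.G k)) (truncEpi g l u g)
      ≤ ENNReal.ofReal (R.gap k * p (0, 1)) := by
  have hbdd := ((isCompact_Icc (a := l) (b := u)).image
    (continuous_of_convexOn_univ hg)).bddAbove
  refine max_le (iSup₂_le fun z hz => ?_) (iSup₂_le fun z hz => ?_)
  · have hzC : z ∈ R.C k := by
      rw [R.C_eq]
      exact hz.1
    have hepi : (z.1, max z.2 (g z.1)) ∈ epi g := le_max_right z.2 (g z.1)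
    have hmem : (z.1, max z.2 (g z.1)) ∈ truncEpi g l u g :=
      ⟨⟨hepi, hz.1.2.1, mem_univ _⟩,
        max_le hz.2 (le_csSup hbdd (mem_image_of_mem g hz.1.2.1))⟩
    refine (iInf₂_le _ hmem).trans ?_
    have hdiff : z - (z.1, max z.2 (g z.1)) = (z.2 - max z.2 (g z.1)) • ((0, 1) : Pt n) := by
      ext <;> simp
    rw [hdiff, map_smul_eq_mul, Real.norm_eq_abs]
    rcases le_total (g z.1) z.2 with h | h
    · simp [max_eq_left h]
    · rw [max_eq_right h, abs_sub_comm, abs_of_nonneg (sub_nonneg.2 h)]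
      exact ENNReal.ofReal_le_ofReal
        (mul_le_mul_of_nonneg_right (R.sub_le_gap hg k hzC) (apply_nonneg p _))
  · have hzC := R.mem_C_of_le k hz.1.2.1 hz.1.1
    rw [R.C_eq] at hzC
    exact (iInf₂_le z (⟨hzC, hz.2⟩ : z ∈ truncEpi g l u (R.G k))).trans (by simp)

end Run

/-- The integer part of `k ^ (1 / n)` is at least half of it. -/
theorem exists_pow_le_and_inv_le {n k : ℕ} (hn : 0 < n) (hk : 0 < k) :
    ∃ N : ℕ, 0 < N ∧ N ^ n ≤ k ∧ ((N : ℝ))⁻¹ ≤ 2 * (k : ℝ) ^ (-(1 / (n : ℝ))) := by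
  have hk1 : (1 : ℝ) ≤ k := Nat.one_le_cast.2 hk
  set r := (k : ℝ) ^ ((n : ℝ)⁻¹) with hr
  have hr1 : 1 ≤ r := Real.one_le_rpow hk1 (by positivity)
  have hN : 0 < ⌊r⌋₊ := Nat.floor_pos.2 hr1
  have hle : (⌊r⌋₊ : ℝ) ≤ r := Nat.floor_le (by linarith)
  have hlt : r < ⌊r⌋₊ + 1 := Nat.lt_floor_add_one r
  have hN1 : (1 : ℝ) ≤ ⌊r⌋₊ := Nat.one_le_cast.2 hN
  refine ⟨⌊r⌋₊, hN, ?_, ?_⟩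
  · have h := pow_le_pow_left₀ (Nat.cast_nonneg _) hle n
    rw [hr, Real.rpow_inv_natCast_pow (Nat.cast_nonneg k) hn.ne', ← hr] at h
    exact_mod_cast h
  · rw [one_div, Real.rpow_neg (Nat.cast_nonneg k), ← hr, ← div_eq_mul_inv,
      inv_le_comm₀ (by linarith) (by positivity), inv_div]
    -- This is `r < ⌊r⌋₊ + 1 ≤ 2 * ⌊r⌋₊`.
    linarith

end CuttingPlane

theorem mainTheorem6 (n : ℕ) (hn : 0 < n) (l u : CuttingPlane.Vec n) (hlu : ∀ i, l i < u i)
    (g : CuttingPlane.Vec n → ℝ) (hg : ConvexOn ℝ Set.univ g)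
    (p : Seminorm ℝ (CuttingPlane.Pt n)) (hp : ∀ z, p z = 0 → z = 0) :
    ∃ M : ℝ, 0 < M ∧ ∀ R : CuttingPlane.Run g l u 0,
      (∀ᶠ k : ℕ in atTop,
        CuttingPlane.hausdorff p (CuttingPlane.truncEpi g l u (R.G k))
            (CuttingPlane.truncEpi g l u g)
          ≤ ENNReal.ofReal (M * (k : ℝ) ^ (-(1 / (n : ℝ))))) ∧
      Tendsto (fun k : ℕ => CuttingPlane.hausdorff p (CuttingPlane.truncEpi g l u (R.G k))
        (CuttingPlane.truncEpi g l u g)) atTop (𝓝 0) := by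
  obtain ⟨L, hL, hLc⟩ :=
    CuttingPlane.exists_subdiff_bound (CuttingPlane.continuous_of_convexOn_univ hg) l u
  have hp1 : 0 < p (0, 1) := (apply_nonneg p _).lt_of_ne fun h => by
    simpa using congrArg Prod.snd (hp _ h.symm)
  -- The 4 is 2 from the two subgradients times 2 from rounding `k ^ (1 / n)` down.
  refine ⟨4 * L * (‖u - l‖ + 1) * p (0, 1), by positivity, fun R => ?_⟩
  have hrate : ∀ᶠ k : ℕ in atTop,
      CuttingPlane.hausdorff p (CuttingPlane.truncEpi g l u (R.G k))
          (CuttingPlane.truncEpi g l u g)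
        ≤ ENNReal.ofReal
            (4 * L * (‖u - l‖ + 1) * p (0, 1) * (k : ℝ) ^ (-(1 / (n : ℝ)))) := by
    filter_upwards [eventually_gt_atTop 0] with k hk
    obtain ⟨N, hN, hNk, hNr⟩ := CuttingPlane.exists_pow_le_and_inv_le hn hk
    refine (R.hausdorff_le hg p k).trans (ENNReal.ofReal_le_ofReal ?_)
    calc R.gap k * p (0, 1)
        ≤ 2 * L * ((‖u - l‖ + 1) / N) * p (0, 1) :=
          mul_le_mul_of_nonneg_right (R.gap_le hg hL hLc hN hNk) hp1.le
      _ = 2 * L * (‖u - l‖ + 1) * p (0, 1) * (N : ℝ)⁻¹ := by ring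
      _ ≤ 2 * L * (‖u - l‖ + 1) * p (0, 1) * (2 * (k : ℝ) ^ (-(1 / (n : ℝ)))) :=
          mul_le_mul_of_nonneg_left hNr (by positivity)
      _ = 4 * L * (‖u - l‖ + 1) * p (0, 1) * (k : ℝ) ^ (-(1 / (n : ℝ))) := by ring
  refine ⟨hrate, tendsto_of_tendsto_of_tendsto_of_le_of_le' tendsto_const_nhds ?_
    (Eventually.of_forall fun _ => zero_le) hrate⟩
  have hpow : Tendsto (fun k : ℕ => (k : ℝ) ^ (-(1 / (n : ℝ)))) atTop (𝓝 0) :=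
    (tendsto_rpow_neg_atTop (by positivity)).comp tendsto_natCast_atTop_atTop
  simpa using ENNReal.tendsto_ofReal (hpow.const_mul (4 * L * (‖u - l‖ + 1) * p (0, 1)))
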